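/- There exists a constant $C>0$ such that for every $\varepsilon>0$ there is an $n_0\in\mathbb{N}$ with the following property. Let $n\ge n_0$ and $m$ be integers with $1\le m\le n/256$, let $G$ be any graph on the vertex set $\{1,\dots,n\}$ with minimum degree $\delta(G)\ge m$, and let $p\in[0,1]$ satisfy $p\ge C\,\frac{\log n}{n}$ (natural logarithm). Let $G(n,p)$ be the binomial random graph on the same vertex set, in which each pair of vertices is an edge independently with probability $p$. Then, with probability at least $1-\varepsilon$, the graph $G\cup G(n,p)$ contains $m$ pairwise vertex-disjoint triangles. In other words, uniformly over all such $m$, $G$ and $p$, the probability that $G\cup G(n,p)$ contains $m$ pairwise vertex-disjoint triangles tends to $1$ as $n\to\infty$. -/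

import Mathlib

/-- The graph `G` contains `m` pairwise vertex-disjoint triangles: there are `m` three-element
cliques of `G`, any two of which have no vertex in common. -/
def SimpleGraph.HasDisjointTriangles {V : Type*} (G : SimpleGraph V) (m : ℕ) : Prop :=
  ∃ T : Finset (Finset V), T.card = m ∧ (∀ t ∈ T, G.IsNClique 3 t) ∧
    (T : Set (Finset V)).Pairwise Disjoint

/-! Let `B` consist of at most m vertices of degree at least n/32: all of them if there are at most
m, otherwise m of them; put k = m - |B|. With high probability every set of at least n/64 vertices
spans a random edge, so vertices of `B` can be absorbed greedily: the neighbourhood of each still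
contains n/64 unused vertices, and a random edge there closes a triangle. It remains to find k
disjoint triangles off `B`. If k > 0, all vertices outside `B` have degree below n/32. Delete `B`
and any set `U` of 3k further vertices. The remaining graph F has degree sum at least kn/2, so it
has either order kn pairs with a common neighbour, each completed by one random edge, or order kn
vertices in isolated edges, where two random edges join an isolated edge to a third vertex. In both
cases F yields no triangle with probability at most n^(-4k), which survives a union bound over the
at most n^(3k) choices of `U`; greedy selection then works. Both random properties concern the same
random graph, so a union bound suffices. -/

open MeasureTheory ProbabilityTheory

/-! ### Independence over disjoint edge sets -/

theorem ProbabilityTheory.iIndep.measure_biInter_eq_prod_of_pairwiseDisjoint {Ω κ ι : Type*} {mΩ : MeasurableSpace Ω}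
    {μ : Measure Ω} [IsProbabilityMeasure μ] {m : κ → MeasurableSpace Ω} (hle : ∀ e, m e ≤ mΩ)
    (hm : iIndep m μ) (I : Finset ι) (E : ι → Set κ) (A : ι → Set Ω)
    (hE : (I : Set ι).PairwiseDisjoint E)
    (hA : ∀ i ∈ I, MeasurableSet[⨆ e ∈ E i, m e] (A i)) :
    μ (⋂ i ∈ I, A i) = ∏ i ∈ I, μ (A i) := by
  classical
  induction I using Finset.induction_on with
  | empty => simp
  | insert a s ha ih =>
    rw [Finset.prod_insert ha, Finset.set_biInter_insert, ← ih]
    · have hdis : Disjoint (E a) (⋃ i ∈ s, E i) := by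
        rw [Set.disjoint_iUnion₂_right]
        intro i hi
        exact hE (by simp) (by simp [hi]) (by rintro rfl; exact ha hi)
      refine (Indep_iff _ _ μ).1 (indep_iSup_of_disjoint hle hm hdis) _ _ (hA a (by simp)) ?_
      refine Finset.measurableSet_biInter _ fun i hi => ?_
      refine (?_ : (⨆ e ∈ E i, m e) ≤ _) _ (hA i (by simp [hi]))
      exact iSup₂_le fun e he => le_iSup₂_of_le e (Set.mem_biUnion hi he) le_rfl
    · exact hE.subset (by simp)
    · exact fun i hi => hA i (by simp [hi])

namespace SimpleGraph

/-- Disjointness makes the events independent, so the probability is (1 - p^k)^|J|, at most exp(-p^k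
|J|). This replaces any second-moment or Janson-type estimate: every later bound chooses disjoint
edge sets. -/
theorem binomialRandom_real_forall_not_subset_le {V ι : Type*} [Finite V] (p : unitInterval) (J : Finset ι)
    (E : ι → Finset (Sym2 V)) (k : ℕ) (hdisj : (J : Set ι).PairwiseDisjoint E)
    (hdiag : ∀ i ∈ J, ∀ e ∈ E i, ¬ e.IsDiag) (hcard : ∀ i ∈ J, (E i).card = k) :
    (binomialRandom V p).real {H | ∀ i ∈ J, ¬ ((E i : Set (Sym2 V)) ⊆ H.edgeSet)} ≤
      Real.exp (-((p : ℝ) ^ k * J.card)) := by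
  classical
  set ν : Sym2 V → Measure Prop :=
    fun e => unitInterval.toNNReal p • Measure.dirac (¬ e.IsDiag) + unitInterval.toNNReal (unitInterval.symm p) • Measure.dirac False with hν
  have hprob : ∀ e, IsProbabilityMeasure (ν e) := fun e => by rw [hν]; infer_instance
  set μ := Measure.infinitePi ν with hμ
  set B : ι → Set (Sym2 V → Prop) := fun i => Set.pi (E i) fun _ => {True} with hB
  have hBmeas : ∀ i, μ.real (B i)ᶜ = 1 - ∏ e ∈ E i, (ν e).real {True} := by
    intro i
    rw [measureReal_compl (MeasurableSet.pi (Finset.countable_toSet _)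
      (fun _ _ => MeasurableSet.of_discrete))]
    rw [probReal_univ]
    simp only [hμ, measureReal_def]
    rw [Measure.infinitePi_pi _ (fun _ _ => MeasurableSet.of_discrete), ENNReal.toReal_prod]
  have hone : ∀ e : Sym2 V, ¬ e.IsDiag → (ν e).real {True} = p := by
    intro e he
    simp [hν, measureReal_def, he]
  have hind : iIndepFun (fun e (ω : Sym2 V → Prop) => ω e) μ :=
    iIndepFun_infinitePi (X := fun _ ω => ω) (fun _ => measurable_id)
  have hprod := iIndep.measure_biInter_eq_prod_of_pairwiseDisjoint
    (m := fun e => (inferInstance : MeasurableSpace Prop).comap fun ω : Sym2 V → Prop => ω e)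
    (fun e => (measurable_pi_apply e).comap_le) hind.iIndep J (fun i => (E i : Set (Sym2 V)))
    (fun i => (B i)ᶜ)
    (fun i hi j hj hij => by simpa using hdisj hi hj hij)
    (fun i _ => by
      refine MeasurableSet.compl ?_
      have : B i = ⋂ e ∈ E i, (fun ω : Sym2 V → Prop => ω e) ⁻¹' {True} := by
        ext ω; simp [hB, Set.mem_pi]
      rw [this]
      refine Finset.measurableSet_biInter _ fun e he => ?_
      exact (le_iSup₂_of_le (f := fun e (_ : e ∈ (E i : Set (Sym2 V))) =>
        (inferInstance : MeasurableSpace Prop).comap fun ω : Sym2 V → Prop => ω e) e he le_rfl) _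
        ⟨{True}, MeasurableSet.of_discrete, rfl⟩)
  have hp0 : (0 : ℝ) ≤ p := p.2.1
  have hp1 : (p : ℝ) ≤ 1 := p.2.2
  calc (binomialRandom V p).real {H | ∀ i ∈ J, ¬ ((E i : Set (Sym2 V)) ⊆ H.edgeSet)}
      ≤ μ.real (⋂ i ∈ J, (B i)ᶜ) := by
        rw [measureReal_def, measureReal_def, binomialRandom_apply]
        refine ENNReal.toReal_mono (measure_ne_top _ _) (measure_mono ?_)
        rintro _ ⟨H, hH, rfl⟩
        simp only [Set.mem_iInter, Set.mem_compl_iff]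
        intro i hi h
        refine hH i hi fun e he => ?_
        simpa using h e he
    _ = ∏ i ∈ J, μ.real (B i)ᶜ := by
        rw [measureReal_def, hprod, ENNReal.toReal_prod]; rfl
    _ = ∏ i ∈ J, (1 - (p : ℝ) ^ k) := by
        refine Finset.prod_congr rfl fun i hi => ?_
        rw [hBmeas, Finset.prod_congr rfl fun e he => hone e (hdiag i hi e he),
          Finset.prod_const, hcard i hi]
    _ = (1 - (p : ℝ) ^ k) ^ J.card := by rw [Finset.prod_const]
    _ ≤ (Real.exp (-(p : ℝ) ^ k)) ^ J.card := by
        refine pow_le_pow_left₀ (sub_nonneg.2 (pow_le_one₀ hp0 hp1)) ?_ _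
        linarith [Real.add_one_le_exp (-(p : ℝ) ^ k)]
    _ = _ := by rw [← Real.exp_nat_mul]; congr 1; ring

end SimpleGraph

/-! ### Degree sum against common-neighbour pairs and isolated edges -/

theorem Finset.card_le_two_mul_card_filter_lt {V : Type*} [LinearOrder V] (P : Finset (V × V))
    (hswap : ∀ z ∈ P, z.swap ∈ P) (hne : ∀ z ∈ P, z.1 ≠ z.2) :
    P.card ≤ 2 * (P.filter fun z => z.1 < z.2).card := by
  classical
  have hsub : P ⊆ (P.filter fun z => z.1 < z.2) ∪ (P.filter fun z => z.1 < z.2).image Prod.swap := by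
    intro z hz
    rcases lt_or_gt_of_ne (hne z hz) with h | h
    · exact Finset.mem_union_left _ (Finset.mem_filter.2 ⟨hz, h⟩)
    · exact Finset.mem_union_right _ (Finset.mem_image.2
        ⟨z.swap, Finset.mem_filter.2 ⟨hswap z hz, h⟩, z.swap_swap⟩)
  have h1 := Finset.card_le_card hsub
  have h2 := Finset.card_union_le (P.filter fun z => z.1 < z.2)
    ((P.filter fun z => z.1 < z.2).image Prod.swap)
  have h3 := Finset.card_image_le (s := P.filter fun z => z.1 < z.2) (f := Prod.swap)
  omega

namespace SimpleGraph

variable {V : Type*} [Fintype V] (F : SimpleGraph V)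

open Classical in
/-- The ordered pairs of distinct vertices that have a common neighbour. -/
noncomputable def commonNeighborPairs : Finset (V × V) :=
  Finset.univ.filter fun z => z.1 ≠ z.2 ∧ ∃ v, F.Adj v z.1 ∧ F.Adj v z.2

open Classical in
/-- The vertices of the components of `F` that are single edges. -/
noncomputable def isolatedEdgeVertices : Finset V :=
  Finset.univ.filter fun x => ∃ v, F.Adj x v ∧ F.degree x = 1 ∧ F.degree v = 1

open Classical in
-- Edges are charged to the endpoint of smaller degree. If some counted v has degree at least 2, its
-- other neighbours pair with x, and deg x ≤ deg v ≤ 2(deg v - 1). Otherwise every counted v has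
-- degree 1, which forces deg x = 1 and an isolated edge.
theorem card_neighbors_degree_le_le (x : V) :
    ((F.neighborFinset x).filter fun v => F.degree x ≤ F.degree v).card ≤
      2 * (Finset.univ.filter fun y => (x, y) ∈ F.commonNeighborPairs).card +
        if x ∈ F.isolatedEdgeVertices then 1 else 0 := by
  set M := (F.neighborFinset x).filter fun v => F.degree x ≤ F.degree v with hM
  have hMx : M.card ≤ F.degree x := Finset.card_filter_le _ _
  by_cases h : ∃ v ∈ M, 2 ≤ F.degree v
  · obtain ⟨v, hv, hv2⟩ := h
    simp only [hM, Finset.mem_filter, mem_neighborFinset] at hv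
    have hsub : (F.neighborFinset v).erase x ⊆
        Finset.univ.filter fun y => (x, y) ∈ F.commonNeighborPairs := by
      intro y hy
      simp only [Finset.mem_erase, mem_neighborFinset] at hy
      simp only [commonNeighborPairs, Finset.mem_filter, Finset.mem_univ, true_and]
      exact ⟨hy.1.symm, v, hv.1.symm, hy.2⟩
    have h1 := Finset.card_le_card hsub
    rw [Finset.card_erase_of_mem (by simpa using hv.1.symm), card_neighborFinset_eq_degree] at h1
    omega
  · push Not at h
    rcases M.eq_empty_or_nonempty with h0 | ⟨v, hv⟩
    · simp [h0]
    · have h2 := h v hv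
      simp only [hM, Finset.mem_filter, mem_neighborFinset] at hv
      have h3 : 0 < F.degree x := (F.degree_pos_iff_exists_adj x).2 ⟨v, hv.1⟩
      have hx : x ∈ F.isolatedEdgeVertices := by
        simp only [isolatedEdgeVertices, Finset.mem_filter, Finset.mem_univ, true_and]
        exact ⟨v, hv.1, by omega, by omega⟩
      rw [if_pos hx]
      omega

open Classical in
theorem sum_degree_le_commonNeighborPairs :
    ∑ v, F.degree v ≤ 4 * F.commonNeighborPairs.card + 2 * F.isolatedEdgeVertices.card := by
  set D : Finset (V × V) := Finset.univ.filter fun z => F.Adj z.1 z.2 with hD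
  set D' := D.filter fun z => F.degree z.1 ≤ F.degree z.2 with hD'
  have hfib : ∀ P : Finset (V × V),
      P.card = ∑ x, (Finset.univ.filter fun y => (x, y) ∈ P).card := by
    intro P
    rw [Finset.card_eq_sum_card_fiberwise (f := Prod.fst) (t := Finset.univ) (by simp)]
    refine Finset.sum_congr rfl fun x _ => ?_
    refine Finset.card_bij' (fun z _ => z.2) (fun y _ => (x, y)) ?_ ?_ ?_ ?_
    · rintro ⟨a, b⟩; simp; rintro h rfl; exact h
    · simp
    · rintro ⟨a, b⟩; simp; rintro - rfl; rfl
    · simp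
  have h1 : ∑ v, F.degree v = D.card := by
    rw [hfib D]
    refine Finset.sum_congr rfl fun x _ => ?_
    rw [← card_neighborFinset_eq_degree]
    congr 1; ext y; simp [hD]
  have h2 : D.card ≤ 2 * D'.card := by
    have hsub : D ⊆ D' ∪ D'.image Prod.swap := by
      intro z hz
      rcases le_total (F.degree z.1) (F.degree z.2) with h | h
      · exact Finset.mem_union_left _ (Finset.mem_filter.2 ⟨hz, h⟩)
      · refine Finset.mem_union_right _ (Finset.mem_image.2
          ⟨z.swap, Finset.mem_filter.2 ⟨?_, h⟩, z.swap_swap⟩)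
        simp only [hD, Finset.mem_filter, Finset.mem_univ, true_and] at hz ⊢
        exact hz.symm
    have h3 := (Finset.card_le_card hsub).trans (Finset.card_union_le _ _)
    have h4 := Finset.card_image_le (s := D') (f := Prod.swap)
    omega
  have h3 : D'.card ≤ 2 * F.commonNeighborPairs.card + F.isolatedEdgeVertices.card := by
    calc D'.card = ∑ x, (Finset.univ.filter fun y => (x, y) ∈ D').card := hfib D'
      _ ≤ ∑ x, (2 * (Finset.univ.filter fun y => (x, y) ∈ F.commonNeighborPairs).card +
        if x ∈ F.isolatedEdgeVertices then 1 else 0) := by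
          refine Finset.sum_le_sum fun x _ => ?_
          have hx : (Finset.univ.filter fun y => (x, y) ∈ D') =
              (F.neighborFinset x).filter fun v => F.degree x ≤ F.degree v := by
            ext y; simp [hD', hD]
          rw [hx]
          exact F.card_neighbors_degree_le_le x
      _ = _ := by
          rw [Finset.sum_add_distrib, ← Finset.mul_sum, ← hfib]
          simp
  omega

end SimpleGraph

/-! ### Probability that random edges close no triangle -/

namespace SimpleGraph

variable {V : Type*} [Fintype V] [LinearOrder V] (F : SimpleGraph V) (p : unitInterval)

theorem binomialRandom_real_no_triangle_le_commonNeighborPairs :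
    (binomialRandom V p).real {H | ∀ t, (F ⊔ H).IsNClique 3 t → ¬ (t : Set V) ⊆ F.support} ≤
      Real.exp (-((p : ℝ) * (F.commonNeighborPairs.card / 2))) := by
  classical
  set J := F.commonNeighborPairs.filter fun z => z.1 < z.2 with hJ
  have hcard : F.commonNeighborPairs.card ≤ 2 * J.card := by
    refine Finset.card_le_two_mul_card_filter_lt _ ?_ ?_
    · rintro ⟨x, y⟩ h
      simp only [commonNeighborPairs, Finset.mem_filter, Finset.mem_univ, true_and,
        Prod.swap_prod_mk] at h ⊢
      obtain ⟨h1, v, h2, h3⟩ := h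
      exact ⟨h1.symm, v, h3, h2⟩
    · rintro ⟨x, y⟩ h
      simp only [commonNeighborPairs, Finset.mem_filter, Finset.mem_univ, true_and] at h
      exact h.1
  have hprob := binomialRandom_real_forall_not_subset_le p J (fun z => {s(z.1, z.2)}) 1
    (by
      rintro ⟨x, y⟩ hz ⟨x', y'⟩ hz' hne
      simp only [hJ, Finset.coe_filter, Set.mem_ofPred_eq] at hz hz'
      simp only [Function.onFun, Finset.disjoint_singleton, ne_eq, Sym2.eq_iff]
      rintro (⟨rfl, rfl⟩ | ⟨rfl, rfl⟩)
      · exact hne rfl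
      · exact lt_asymm hz.2 hz'.2)
    (by
      rintro ⟨x, y⟩ hz e he
      simp only [hJ, Finset.mem_filter] at hz
      simp only [Finset.mem_singleton] at he
      subst he
      simpa using hz.2.ne)
    (by simp)
  refine (measureReal_mono ?_).trans (hprob.trans (Real.exp_le_exp.2 (neg_le_neg ?_)))
  · intro H hH
    rintro ⟨x, y⟩ hz hxy
    simp only [hJ, Finset.mem_filter, commonNeighborPairs, Finset.mem_univ, true_and] at hz
    obtain ⟨⟨hne, v, hvx, hvy⟩, -⟩ := hz
    have hxy' : H.Adj x y := by simpa using hxy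
    refine hH {v, x, y} (is3Clique_triple_iff.2 ⟨Or.inl hvx, Or.inl hvy, Or.inr hxy'⟩) ?_
    intro u hu
    simp only [Finset.coe_insert, Finset.coe_singleton, Set.mem_insert_iff,
      Set.mem_singleton_iff] at hu
    rcases hu with rfl | rfl | rfl
    · exact ⟨_, hvx⟩
    · exact ⟨_, hvx.symm⟩
    · exact ⟨_, hvy.symm⟩
  · rw [pow_one]
    refine mul_le_mul_of_nonneg_left ?_ p.2.1
    have : (F.commonNeighborPairs.card : ℝ) ≤ 2 * J.card := by exact_mod_cast hcard
    linarith

/-- Two isolated edges with representatives x and w give a triangle on x, its partner and w once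
both random pairs from w are present. Fixing one representative per edge and taking x < w keeps
these 2-edge sets disjoint. -/
theorem binomialRandom_real_no_triangle_le_isolatedEdgeVertices
    (h4 : 4 ≤ F.isolatedEdgeVertices.card) :
    (binomialRandom V p).real {H | ∀ t, (F ⊔ H).IsNClique 3 t → ¬ (t : Set V) ⊆ F.support} ≤
      Real.exp (-((p : ℝ) ^ 2 * (F.isolatedEdgeVertices.card ^ 2 / 16))) := by
  classical
  have hg : ∀ x, ∃ v, x ∈ F.isolatedEdgeVertices →
      F.Adj x v ∧ F.degree x = 1 ∧ F.degree v = 1 := by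
    intro x
    by_cases hx : x ∈ F.isolatedEdgeVertices
    · obtain ⟨v, hv⟩ := (Finset.mem_filter.1 hx).2
      exact ⟨v, fun _ => by convert hv⟩
    · exact ⟨x, fun h => absurd h hx⟩
  choose g hg using hg
  have huniq : ∀ x ∈ F.isolatedEdgeVertices, ∀ y, F.Adj x y → y = g x := by
    intro x hx y hy
    obtain ⟨a, ha⟩ := Finset.card_eq_one.1 (hg x hx).2.1
    have h1 : y ∈ F.neighborFinset x := by simpa using hy
    have h2 : g x ∈ F.neighborFinset x := by simpa using (hg x hx).1
    rw [ha, Finset.mem_singleton] at h1 h2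
    rw [h1, h2]
  have hgmem : ∀ x ∈ F.isolatedEdgeVertices, g x ∈ F.isolatedEdgeVertices := by
    intro x hx
    obtain ⟨h1, h2, h3⟩ := hg x hx
    refine Finset.mem_filter.2 ⟨Finset.mem_univ _, x, h1.symm, ?_, ?_⟩
    · convert h3
    · convert h2
  have hinv : ∀ x ∈ F.isolatedEdgeVertices, g (g x) = x := fun x hx =>
    (huniq (g x) (hgmem x hx) x (hg x hx).1.symm).symm
  -- One representative, the smaller endpoint, of each isolated edge.
  set A := F.isolatedEdgeVertices.filter fun x => x < g x with hA
  have hIA : F.isolatedEdgeVertices.card ≤ 2 * A.card := by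
    have hsub : F.isolatedEdgeVertices ⊆ A ∪ A.image g := by
      intro x hx
      rcases lt_or_gt_of_ne (hg x hx).1.ne with h | h
      · exact Finset.mem_union_left _ (Finset.mem_filter.2 ⟨hx, h⟩)
      · exact Finset.mem_union_right _ (Finset.mem_image.2
          ⟨g x, Finset.mem_filter.2 ⟨hgmem x hx, by rwa [hinv x hx]⟩, hinv x hx⟩)
    have h1 := (Finset.card_le_card hsub).trans (Finset.card_union_le _ _)
    have h2 := Finset.card_image_le (s := A) (f := g)
    omega
  have hAI : ∀ x ∈ A, x ∈ F.isolatedEdgeVertices := fun x hx => (Finset.mem_filter.1 hx).1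
  have hgA : ∀ x ∈ A, g x ∉ A := by
    intro x hx h
    have h1 := (Finset.mem_filter.1 hx).2
    have h2 := (Finset.mem_filter.1 h).2
    rw [hinv x (hAI x hx)] at h2
    exact lt_asymm h1 h2
  set J := A.offDiag.filter fun z => z.1 < z.2 with hJ
  have hJA : A.card * A.card - A.card ≤ 2 * J.card := by
    rw [← Finset.offDiag_card]
    refine Finset.card_le_two_mul_card_filter_lt _ ?_ ?_
    · rintro ⟨x, y⟩ h
      simp only [Finset.mem_offDiag, Prod.swap_prod_mk] at h ⊢
      exact ⟨h.2.1, h.1, h.2.2.symm⟩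
    · rintro ⟨x, y⟩ h
      exact (Finset.mem_offDiag.1 h).2.2
  have hJmem : ∀ z ∈ J, z.1 ∈ A ∧ z.2 ∈ A ∧ z.1 < z.2 := by
    intro z hz
    simp only [hJ, Finset.mem_filter, Finset.mem_offDiag] at hz
    exact ⟨hz.1.1, hz.1.2.1, hz.2⟩
  have hne : ∀ z ∈ J, z.1 ≠ g z.1 := fun z hz => (hg _ (hAI _ (hJmem z hz).1)).1.ne
  have hne' : ∀ z ∈ J, g z.1 ≠ z.2 := fun z hz h =>
    hgA z.1 (hJmem z hz).1 (h ▸ (hJmem z hz).2.1)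
  have hprob := binomialRandom_real_forall_not_subset_le p J
    (fun z => {s(z.1, z.2), s(g z.1, z.2)}) 2
    (by
      rintro z hz z' hz' hzz
      obtain ⟨h1, h2, h3⟩ := hJmem z hz
      obtain ⟨h1', h2', h3'⟩ := hJmem z' hz'
      have k1 := hgA _ h1
      have k1' := hgA _ h1'
      simp only [Function.onFun, Finset.disjoint_left, Finset.mem_insert, Finset.mem_singleton]
      rintro e (rfl | rfl) (h | h) <;> rw [Sym2.eq_iff] at h
      · rcases h with ⟨h, h'⟩ | ⟨h, h'⟩
        · exact hzz (Prod.ext h h')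
        · rw [h, h'] at h3; exact lt_asymm h3 h3'
      · rcases h with ⟨h, h'⟩ | ⟨h, h'⟩
        · exact k1' (h ▸ h1)
        · exact k1' (h' ▸ h2)
      · rcases h with ⟨h, h'⟩ | ⟨h, h'⟩
        · exact k1 (h ▸ h1')
        · exact k1 (h ▸ h2')
      · rcases h with ⟨h, h'⟩ | ⟨h, h'⟩
        · refine hzz (Prod.ext ?_ h')
          rw [← hinv _ (hAI _ h1), h, hinv _ (hAI _ h1')]
        · exact k1 (h ▸ h2'))
    (by
      rintro z hz e he
      simp only [Finset.mem_insert, Finset.mem_singleton] at he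
      rcases he with rfl | rfl
      · simpa using (hJmem z hz).2.2.ne
      · simpa using hne' z hz)
    (by
      intro z hz
      refine Finset.card_pair fun h => ?_
      rcases Sym2.eq_iff.1 h with ⟨h, -⟩ | ⟨h, -⟩
      · exact hne z hz h
      · exact (hJmem z hz).2.2.ne h)
  refine (measureReal_mono ?_).trans (hprob.trans (Real.exp_le_exp.2 (neg_le_neg ?_)))
  · intro H hH z hz hsub
    have hxw : H.Adj z.1 z.2 := by
      have : s(z.1, z.2) ∈ H.edgeSet := hsub (by simp)
      simpa using this
    have hgw : H.Adj (g z.1) z.2 := by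
      have : s(g z.1, z.2) ∈ H.edgeSet := hsub (by simp)
      simpa using this
    have hxg := (hg _ (hAI _ (hJmem z hz).1)).1
    have hw := (hg _ (hAI _ (hJmem z hz).2.1)).1
    refine hH {z.1, g z.1, z.2} (is3Clique_triple_iff.2 ⟨Or.inl hxg, Or.inr hxw, Or.inr hgw⟩) ?_
    intro u hu
    simp only [Finset.coe_insert, Finset.coe_singleton, Set.mem_insert_iff,
      Set.mem_singleton_iff] at hu
    rcases hu with rfl | rfl | rfl
    · exact ⟨_, hxg⟩
    · exact ⟨_, hxg.symm⟩
    · exact ⟨_, hw⟩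
  · refine mul_le_mul_of_nonneg_left ?_ (sq_nonneg _)
    have h1 : (F.isolatedEdgeVertices.card : ℝ) ≤ 2 * A.card := by exact_mod_cast hIA
    have h2 : (A.card : ℝ) * A.card ≤ 2 * J.card + A.card := by
      have : A.card * A.card ≤ 2 * J.card + A.card := by omega
      exact_mod_cast this
    have h3 : (2 : ℝ) ≤ A.card := by
      have : 2 ≤ A.card := by omega
      exact_mod_cast this
    -- For a = |A| ≥ 2, a(a-1)/2 ≥ a²/4, and a is at least half the number of vertices.
    nlinarith [Nat.cast_nonneg (α := ℝ) F.isolatedEdgeVertices.card]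

end SimpleGraph

/-! ### Triangles avoiding a deleted vertex set -/

namespace SimpleGraph

theorem support_spanningCoe_induce_subset {V : Type*} (G : SimpleGraph V) (s : Set V) :
    (G.induce s).spanningCoe.support ⊆ s := by
  rintro x ⟨y, hxy⟩
  simp only [map_adj, comap_adj] at hxy
  obtain ⟨a, b, -, rfl, rfl⟩ := hxy
  exact a.2

open Classical in
-- Each surviving vertex keeps degree at least k apart from its edges into `U`. Those number at most
-- 3k · n/32 in total, since vertices of `U` have low degree, while at least 253n/256 vertices
-- survive.
theorem mul_card_le_two_mul_sum_degree_induce {V : Type*} [Fintype V] (G : SimpleGraph V)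
    (B U : Finset V) (k : ℕ) (hBU : Disjoint B U) (hU : U.card ≤ 3 * k)
    (hN : 256 * (k + B.card) ≤ Fintype.card V) (hmin : ∀ v, k + B.card ≤ G.degree v)
    (hmax : ∀ v, v ∉ B → 32 * G.degree v ≤ Fintype.card V) :
    k * Fintype.card V ≤
      2 * ∑ v, (G.induce ((B ∪ U)ᶜ : Set V)).spanningCoe.degree v := by
  set S : Finset V := (B ∪ U)ᶜ with hS
  set F := (G.induce ((B ∪ U)ᶜ : Set V)).spanningCoe with hF
  have hadj : ∀ x y, F.Adj x y ↔ G.Adj x y ∧ x ∈ S ∧ y ∈ S := by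
    intro x y
    simp only [hF, map_adj, comap_adj, hS, Finset.mem_compl, Finset.mem_union]
    constructor
    · rintro ⟨a, b, h, rfl, rfl⟩
      refine ⟨h, ?_, ?_⟩
      · simpa using a.2
      · simpa using b.2
    · rintro ⟨h, hx, hy⟩
      exact ⟨⟨x, by simpa using hx⟩, ⟨y, by simpa using hy⟩, h, rfl, rfl⟩
  have h1 : ∀ v ∈ S, k ≤ F.degree v + (U.filter fun u => G.Adj v u).card := by
    intro v hv
    have hsub : G.neighborFinset v ⊆ (F.neighborFinset v ∪ U.filter fun u => G.Adj v u) ∪ B := by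
      intro w hw
      have hvw : G.Adj v w := by simpa using hw
      simp only [Finset.mem_union, mem_neighborFinset, hadj, Finset.mem_filter]
      by_cases hwB : w ∈ B
      · exact Or.inr hwB
      by_cases hwU : w ∈ U
      · exact Or.inl (Or.inr ⟨hwU, hvw⟩)
      · exact Or.inl (Or.inl ⟨hvw, hv, by simp [hS, hwB, hwU]⟩)
    have h2 := (Finset.card_le_card hsub).trans (Finset.card_union_le _ _)
    have h3 := Finset.card_union_le (F.neighborFinset v) (U.filter fun u => G.Adj v u)
    have h4 := hmin v
    rw [card_neighborFinset_eq_degree] at h2 h3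
    omega
  have h2 : ∑ v ∈ S, (U.filter fun u => G.Adj v u).card =
      ∑ u ∈ U, (S.filter fun v => G.Adj v u).card :=
    Finset.sum_card_bipartiteAbove_eq_sum_card_bipartiteBelow (fun v u => G.Adj v u)
  have h3 : 32 * ∑ u ∈ U, (S.filter fun v => G.Adj v u).card ≤ U.card * Fintype.card V := by
    rw [Finset.mul_sum]
    refine Finset.sum_le_card_nsmul _ _ _ fun u hu => ?_
    refine le_trans (Nat.mul_le_mul_left 32 ?_) (hmax u (Finset.disjoint_right.1 hBU hu))
    rw [← card_neighborFinset_eq_degree]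
    refine Finset.card_le_card fun v hv => ?_
    simpa using (Finset.mem_filter.1 hv).2.symm
  have h4 : S.card * k ≤ ∑ v, F.degree v + ∑ v ∈ S, (U.filter fun u => G.Adj v u).card := by
    calc S.card * k ≤ ∑ v ∈ S, (F.degree v + (U.filter fun u => G.Adj v u).card) := by
          simpa using Finset.card_nsmul_le_sum S _ k h1
      _ = ∑ v ∈ S, F.degree v + _ := Finset.sum_add_distrib
      _ ≤ _ := Nat.add_le_add_right
          (Finset.sum_le_univ_sum_of_nonneg fun _ => Nat.zero_le _) _
  have h5 : Fintype.card V ≤ S.card + (B.card + U.card) := by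
    have := Finset.card_union_le B U
    have := Finset.card_add_card_compl (B ∪ U)
    rw [← hS] at this
    omega
  rw [h2] at h4
  have h6 : U.card * Fintype.card V ≤ 3 * k * Fintype.card V := Nat.mul_le_mul_right _ hU
  have h7 : 253 * Fintype.card V ≤ 256 * S.card := by omega
  have h8 : 253 * Fintype.card V * k ≤ 256 * S.card * k := Nat.mul_le_mul_right _ h7
  nlinarith [Nat.zero_le (k * Fintype.card V)]

variable {V : Type*} [Fintype V] [LinearOrder V]

open Classical in
theorem binomialRandom_real_no_triangle_disjoint_le (G : SimpleGraph V) (p : unitInterval)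
    (B U : Finset V) (k : ℕ) (hk : 1 ≤ k) (hBU : Disjoint B U) (hU : U.card ≤ 3 * k)
    (hN : 256 * (k + B.card) ≤ Fintype.card V) (hmin : ∀ v, k + B.card ≤ G.degree v)
    (hmax : ∀ v, v ∉ B → 32 * G.degree v ≤ Fintype.card V)
    (hp : 128 * Real.log (Fintype.card V) / Fintype.card V ≤ p) :
    (binomialRandom V p).real
        {H | ∀ t, (G ⊔ H).IsNClique 3 t → ¬ (Disjoint t B ∧ Disjoint t U)} ≤
      Real.exp (-(4 * k * Real.log (Fintype.card V))) := by
  set F := (G.induce ((B ∪ U)ᶜ : Set V)).spanningCoe with hF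
  have hFG : F ≤ G := G.spanningCoe_induce_le _
  have hsub : {H : SimpleGraph V | ∀ t, (G ⊔ H).IsNClique 3 t → ¬ (Disjoint t B ∧ Disjoint t U)} ⊆
      {H | ∀ t, (F ⊔ H).IsNClique 3 t → ¬ (t : Set V) ⊆ F.support} := by
    intro H hH t ht hts
    refine hH t (ht.mono (sup_le_sup_right hFG H)) ?_
    have h := hts.trans (G.support_spanningCoe_induce_subset _)
    constructor <;> refine Finset.disjoint_left.2 fun x hx hx' => h hx ?_
    · exact Or.inl hx'
    · exact Or.inr hx'
  refine (measureReal_mono hsub).trans ?_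
  have hdeg : k * Fintype.card V ≤ 2 * ∑ v, F.degree v := by
    convert G.mul_card_le_two_mul_sum_degree_induce B U k hBU hU hN hmin hmax
  have hQI : ∑ v, F.degree v ≤
      4 * F.commonNeighborPairs.card + 2 * F.isolatedEdgeVertices.card := by
    convert F.sum_degree_le_commonNeighborPairs
  have hk' : (1 : ℝ) ≤ k := by exact_mod_cast hk
  have hNpos : (256 : ℝ) ≤ Fintype.card V := by
    have : 256 ≤ Fintype.card V := by omega
    exact_mod_cast this
  set N : ℝ := (Fintype.card V : ℝ) with hNdef
  have hlog : 1 ≤ Real.log N := by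
    rw [Real.le_log_iff_exp_le (by linarith)]
    linarith [Real.exp_one_lt_d9]
  have hpN : 128 * Real.log N ≤ p * N := by rwa [div_le_iff₀ (by linarith)] at hp
  by_cases hQ : k * Fintype.card V ≤ 16 * F.commonNeighborPairs.card
  · refine (binomialRandom_real_no_triangle_le_commonNeighborPairs F p).trans ?_
    refine Real.exp_le_exp.2 (neg_le_neg ?_)
    have hQ' : k * N ≤ 16 * F.commonNeighborPairs.card := by rw [hNdef]; exact_mod_cast hQ
    have h1 : (p : ℝ) * (k * N) ≤ p * (16 * F.commonNeighborPairs.card) :=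
      mul_le_mul_of_nonneg_left hQ' p.2.1
    have h2 : k * (128 * Real.log N) ≤ k * (p * N) :=
      mul_le_mul_of_nonneg_left hpN (by linarith)
    linarith
  -- The pairs account for less than kn/4 of a degree sum of at least kn/2.
  · have hI : k * Fintype.card V ≤ 8 * F.isolatedEdgeVertices.card := by
      omega
    have hI4 : 4 ≤ F.isolatedEdgeVertices.card := by
      have : 1 * Fintype.card V ≤ k * Fintype.card V := Nat.mul_le_mul_right _ hk
      omega
    refine (binomialRandom_real_no_triangle_le_isolatedEdgeVertices F p hI4).trans ?_
    refine Real.exp_le_exp.2 (neg_le_neg ?_)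
    have hI' : k * N ≤ 8 * F.isolatedEdgeVertices.card := by rw [hNdef]; exact_mod_cast hI
    have h1 : (p : ℝ) * (k * N) ≤ p * (8 * F.isolatedEdgeVertices.card) :=
      mul_le_mul_of_nonneg_left hI' p.2.1
    have h2 : k * (128 * Real.log N) ≤ k * (p * N) :=
      mul_le_mul_of_nonneg_left hpN (by linarith)
    have h3 : 16 * (k * Real.log N) ≤ p * F.isolatedEdgeVertices.card := by linarith
    have hkl : 1 ≤ k * Real.log N := one_le_mul_of_one_le_of_one_le hk' hlog
    have h4 : (16 * (k * Real.log N)) ^ 2 ≤ (p * F.isolatedEdgeVertices.card) ^ 2 :=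
      pow_le_pow_left₀ (by linarith) h3 2
    -- The exponent is at least 16(k log n)², and k log n ≥ 1.
    nlinarith

open Classical in
theorem binomialRandom_real_exists_no_triangle_disjoint_le (G : SimpleGraph V) (p : unitInterval)
    (B : Finset V) (k : ℕ) (hk : 1 ≤ k)
    (hN : 256 * (k + B.card) ≤ Fintype.card V) (hmin : ∀ v, k + B.card ≤ G.degree v)
    (hmax : ∀ v, v ∉ B → 32 * G.degree v ≤ Fintype.card V)
    (hp : 128 * Real.log (Fintype.card V) / Fintype.card V ≤ p) :
    (binomialRandom V p).real {H | ∃ U : Finset V, Disjoint B U ∧ U.card = 3 * k ∧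
        ∀ t, (G ⊔ H).IsNClique 3 t → ¬ (Disjoint t B ∧ Disjoint t U)} ≤
      1 / Fintype.card V := by
  set 𝒰 := ((Finset.univ : Finset V).powersetCard (3 * k)).filter fun U => Disjoint B U with h𝒰
  have hN0 : (1 : ℝ) ≤ Fintype.card V := by
    have : 1 ≤ Fintype.card V := by omega
    exact_mod_cast this
  have hsub : {H : SimpleGraph V | ∃ U : Finset V, Disjoint B U ∧ U.card = 3 * k ∧
        ∀ t, (G ⊔ H).IsNClique 3 t → ¬ (Disjoint t B ∧ Disjoint t U)} ⊆
      ⋃ U ∈ 𝒰, {H | ∀ t, (G ⊔ H).IsNClique 3 t → ¬ (Disjoint t B ∧ Disjoint t U)} := by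
    rintro H ⟨U, hBU, hU, h⟩
    refine Set.mem_biUnion (x := U) ?_ h
    simp [h𝒰, hBU, hU]
  have hcard : (𝒰.card : ℝ) ≤ (Fintype.card V : ℝ) ^ (3 * k) := by
    have h1 : 𝒰.card ≤ (Fintype.card V).choose (3 * k) := by
      refine (Finset.card_filter_le _ _).trans ?_
      simp
    exact_mod_cast h1.trans (Nat.choose_le_pow _ _)
  calc (binomialRandom V p).real _
      ≤ (binomialRandom V p).real (⋃ U ∈ 𝒰,
          {H | ∀ t, (G ⊔ H).IsNClique 3 t → ¬ (Disjoint t B ∧ Disjoint t U)}) :=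
        measureReal_mono hsub (measure_ne_top _ _)
    _ ≤ ∑ U ∈ 𝒰, (binomialRandom V p).real
          {H | ∀ t, (G ⊔ H).IsNClique 3 t → ¬ (Disjoint t B ∧ Disjoint t U)} :=
        measureReal_biUnion_finset_le _ _
    _ ≤ ∑ U ∈ 𝒰, Real.exp (-(4 * k * Real.log (Fintype.card V))) := by
        refine Finset.sum_le_sum fun U hU => ?_
        simp only [h𝒰, Finset.mem_filter, Finset.mem_powersetCard] at hU
        exact binomialRandom_real_no_triangle_disjoint_le G p B U k hk hU.2 hU.1.2.le
          hN hmin hmax hp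
    _ = 𝒰.card * ((Fintype.card V : ℝ) ^ (4 * k))⁻¹ := by
        rw [Finset.sum_const, nsmul_eq_mul, Real.exp_neg]
        congr 2
        rw [← Real.exp_log (show (0 : ℝ) < Fintype.card V by linarith), ← Real.exp_nat_mul,
          Real.log_exp]
        push_cast; ring_nf
    _ ≤ (Fintype.card V : ℝ) ^ (3 * k) * ((Fintype.card V : ℝ) ^ (4 * k))⁻¹ := by gcongr
    -- The exponent 4k beats the 3k of the union bound, leaving a factor n^(-k).
    _ = ((Fintype.card V : ℝ) ^ k)⁻¹ := by
        have : (Fintype.card V : ℝ) ≠ 0 := by linarith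
        rw [show 4 * k = 3 * k + k by ring, pow_add]
        field_simp
    _ ≤ 1 / Fintype.card V := by
        rw [one_div]
        exact inv_anti₀ (by linarith) (le_self_pow₀ hN0 (by omega))

/-! ### Large sets independent in the random graph -/

theorem binomialRandom_real_exists_large_independent_le (p : unitInterval)
    (hN : 128 ≤ Fintype.card V)
    (hp : 32768 * Real.log (Fintype.card V) / Fintype.card V ≤ p) :
    (binomialRandom V p).real {H | ∃ S : Finset V, Fintype.card V ≤ 64 * S.card ∧
        ∀ x ∈ S, ∀ y ∈ S, ¬ H.Adj x y} ≤ 1 / Fintype.card V := by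
  classical
  set 𝒮 := (Finset.univ : Finset (Finset V)).filter fun S => Fintype.card V ≤ 64 * S.card with h𝒮
  have hNR : (128 : ℝ) ≤ Fintype.card V := by exact_mod_cast hN
  set N : ℝ := (Fintype.card V : ℝ) with hNdef
  have hlog : 1 ≤ Real.log N := by
    rw [Real.le_log_iff_exp_le (by linarith)]
    linarith [Real.exp_one_lt_d9]
  have hpN : 32768 * Real.log N ≤ p * N := by rwa [div_le_iff₀ (by linarith)] at hp
  have hone : ∀ S ∈ 𝒮, (binomialRandom V p).real {H | ∀ x ∈ S, ∀ y ∈ S, ¬ H.Adj x y} ≤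
      Real.exp (-(2 * N)) := by
    intro S hS
    have hS' := (Finset.mem_filter.1 hS).2
    set J := S.offDiag.filter fun z => z.1 < z.2 with hJ
    have hJS : S.card * S.card - S.card ≤ 2 * J.card := by
      rw [← Finset.offDiag_card]
      refine Finset.card_le_two_mul_card_filter_lt _ ?_ ?_
      · rintro ⟨x, y⟩ h
        simp only [Finset.mem_offDiag, Prod.swap_prod_mk] at h ⊢
        exact ⟨h.2.1, h.1, h.2.2.symm⟩
      · rintro ⟨x, y⟩ h
        exact (Finset.mem_offDiag.1 h).2.2
    have hJmem : ∀ z ∈ J, z.1 ∈ S ∧ z.2 ∈ S ∧ z.1 < z.2 := by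
      intro z hz
      simp only [hJ, Finset.mem_filter, Finset.mem_offDiag] at hz
      exact ⟨hz.1.1, hz.1.2.1, hz.2⟩
    have hprob := binomialRandom_real_forall_not_subset_le p J (fun z => {s(z.1, z.2)}) 1
      (by
        rintro z hz z' hz' hne
        simp only [Function.onFun, Finset.disjoint_singleton, ne_eq, Sym2.eq_iff]
        rintro (⟨h, h'⟩ | ⟨h, h'⟩)
        · exact hne (Prod.ext h h')
        · have h3 := (hJmem z hz).2.2
          rw [h, h'] at h3
          exact lt_asymm h3 (hJmem z' hz').2.2)
      (by
        rintro z hz e he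
        rw [Finset.mem_singleton.1 he]
        simpa using (hJmem z hz).2.2.ne)
      (by simp)
    refine (measureReal_mono ?_).trans (hprob.trans (Real.exp_le_exp.2 (neg_le_neg ?_)))
    · intro H hH z hz hsub
      exact hH _ (hJmem z hz).1 _ (hJmem z hz).2.1 (by simpa using hsub)
    · have h1 : (S.card : ℝ) * S.card ≤ 2 * J.card + S.card := by
        have : S.card * S.card ≤ 2 * J.card + S.card := by omega
        exact_mod_cast this
      have h2 : N ≤ 64 * S.card := by rw [hNdef]; exact_mod_cast hS'
      -- At least |S|²/4 pairs with |S| ≥ N/64, and 16384 = 4 · 64². Twice this number is the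
      -- constant in the bound on p, giving exp(-2N) against at most 2^N sets.
      have h3 : N ^ 2 ≤ 16384 * J.card := by nlinarith
      have h4 : p * N * N ≤ p * (16384 * J.card) := by
        rw [mul_assoc, ← pow_two]
        exact mul_le_mul_of_nonneg_left h3 p.2.1
      have h5 : 32768 * N ≤ p * N * N :=
        mul_le_mul_of_nonneg_right (by linarith) (by linarith)
      rw [pow_one]
      linarith
  calc (binomialRandom V p).real _
      ≤ (binomialRandom V p).real (⋃ S ∈ 𝒮, {H | ∀ x ∈ S, ∀ y ∈ S, ¬ H.Adj x y}) := by
        refine measureReal_mono ?_ (measure_ne_top _ _)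
        rintro H ⟨S, hS, h⟩
        exact Set.mem_biUnion (x := S) (by simpa [h𝒮] using hS) h
    _ ≤ ∑ S ∈ 𝒮, (binomialRandom V p).real {H | ∀ x ∈ S, ∀ y ∈ S, ¬ H.Adj x y} :=
        measureReal_biUnion_finset_le _ _
    _ ≤ ∑ S ∈ 𝒮, Real.exp (-(2 * N)) := Finset.sum_le_sum hone
    _ = 𝒮.card * Real.exp (-(2 * N)) := by rw [Finset.sum_const, nsmul_eq_mul]
    _ ≤ Real.exp N * Real.exp (-(2 * N)) := by
        gcongr
        have h1 : (𝒮.card : ℝ) ≤ 2 ^ Fintype.card V := by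
          have : 𝒮.card ≤ 2 ^ Fintype.card V := by
            simpa using Finset.card_filter_le (Finset.univ : Finset (Finset V))
              fun S => Fintype.card V ≤ 64 * S.card
          exact_mod_cast this
        refine h1.trans ?_
        calc (2 : ℝ) ^ Fintype.card V ≤ Real.exp 1 ^ Fintype.card V := by
              gcongr
              linarith [Real.exp_one_gt_d9]
          _ = Real.exp N := by rw [← Real.exp_nat_mul, mul_one]
    _ = (Real.exp N)⁻¹ := by rw [← Real.exp_add, ← Real.exp_neg]; congr 1; ring
    _ ≤ 1 / N := by
        rw [one_div]
        exact inv_anti₀ (by linarith) (by linarith [Real.add_one_le_exp N])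

end SimpleGraph

/-! ### Greedy construction of disjoint triangles -/

namespace SimpleGraph

variable {V : Type*} [DecidableEq V]

theorem card_biUnion_le_three_mul {K : SimpleGraph V} {T : Finset (Finset V)}
    (hT : ∀ t ∈ T, K.IsNClique 3 t) : (T.biUnion id).card ≤ 3 * T.card := by
  rw [mul_comm]
  exact Finset.card_biUnion_le_card_mul _ _ _ fun t ht => (hT t ht).card_eq.le

theorem exists_insert_disjoint_triangle {K : SimpleGraph V} {T : Finset (Finset V)}
    (hT : ∀ t ∈ T, K.IsNClique 3 t) (hd : (T : Set (Finset V)).Pairwise Disjoint)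
    {t : Finset V} (ht : K.IsNClique 3 t) (htT : Disjoint t (T.biUnion id)) :
    (insert t T).card = T.card + 1 ∧ (∀ u ∈ insert t T, K.IsNClique 3 u) ∧
      ((insert t T : Finset (Finset V)) : Set (Finset V)).Pairwise Disjoint := by
  have htu : ∀ u ∈ T, Disjoint t u := fun u hu =>
    Finset.disjoint_of_subset_right (Finset.subset_biUnion_of_mem id hu) htT
  refine ⟨Finset.card_insert_of_notMem fun h => ?_, ?_, ?_⟩
  · have h1 : t = ∅ := by simpa using htu t h
    have h2 := ht.card_eq
    simp [h1] at h2
  · intro u hu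
    rcases Finset.mem_insert.1 hu with rfl | hu
    · exact ht
    · exact hT u hu
  · rw [Finset.coe_insert]
    exact (Set.pairwise_insert_of_symm).2
      ⟨hd, fun u hu _ => htu u hu⟩

variable [Fintype V]

theorem exists_disjoint_triangles_avoiding (K : SimpleGraph V) (B : Finset V) (k : ℕ)
    (hN : 3 * k + B.card ≤ Fintype.card V)
    (h : ∀ U : Finset V, Disjoint B U → U.card = 3 * k →
      ∃ t, K.IsNClique 3 t ∧ Disjoint t B ∧ Disjoint t U) :
    ∃ T : Finset (Finset V), T.card = k ∧ (∀ t ∈ T, K.IsNClique 3 t) ∧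
      (T : Set (Finset V)).Pairwise Disjoint ∧ Disjoint (T.biUnion id) B := by
  have key : ∀ j ≤ k, ∃ T : Finset (Finset V), T.card = j ∧ (∀ t ∈ T, K.IsNClique 3 t) ∧
      (T : Set (Finset V)).Pairwise Disjoint ∧ Disjoint (T.biUnion id) B := by
    intro j
    induction j with
    | zero => exact fun _ => ⟨∅, by simp⟩
    | succ j ih =>
      intro hj
      obtain ⟨T, hTc, hT, hd, hTB⟩ := ih (by omega)
      have hsub : T.biUnion id ⊆ Bᶜ := fun x hx =>
        Finset.mem_compl.2 (Finset.disjoint_left.1 hTB hx)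
      have hBc := Finset.card_add_card_compl B
      have hTu := card_biUnion_le_three_mul hT
      -- The used vertices are padded outside `B` to size exactly 3k, the only size the hypothesis
      -- covers.
      obtain ⟨U, hTU, hUB, hU⟩ := Finset.exists_subsuperset_card_eq (n := 3 * k) hsub
        (by omega) (by omega)
      obtain ⟨t, ht, htB, htU⟩ := h U
        (Finset.disjoint_left.2 fun x hx hxU => Finset.mem_compl.1 (hUB hxU) hx) hU
      obtain ⟨h1, h2, h3⟩ := exists_insert_disjoint_triangle hT hd ht
        (Finset.disjoint_of_subset_right hTU htU)
      refine ⟨insert t T, by omega, h2, h3, ?_⟩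
      rw [Finset.biUnion_insert, Finset.disjoint_union_left]
      exact ⟨htB, hTB⟩
  exact key k le_rfl

/-- Vertices of `B` are absorbed one at a time, keeping the rest of `B` untouched. Used vertices and
`B` together number at most 4(k + |B|) ≤ n/64, so half of the n/32 guaranteed neighbours remain. -/
theorem exists_disjoint_triangles_extend (G H : SimpleGraph V) [DecidableRel G.Adj] (B : Finset V)
    (k : ℕ) (hN : 256 * (k + B.card) ≤ Fintype.card V)
    (hdeg : ∀ v ∈ B, Fintype.card V ≤ 32 * G.degree v)
    (hH : ∀ S : Finset V, Fintype.card V ≤ 64 * S.card → ∃ x ∈ S, ∃ y ∈ S, H.Adj x y)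
    (T₀ : Finset (Finset V)) (hc : T₀.card = k) (hT₀ : ∀ t ∈ T₀, (G ⊔ H).IsNClique 3 t)
    (hd₀ : (T₀ : Set (Finset V)).Pairwise Disjoint) (hB₀ : Disjoint (T₀.biUnion id) B) :
    (G ⊔ H).HasDisjointTriangles (k + B.card) := by
  have key : ∀ B' ⊆ B, ∃ T : Finset (Finset V), T.card = k + B'.card ∧
      (∀ t ∈ T, (G ⊔ H).IsNClique 3 t) ∧ (T : Set (Finset V)).Pairwise Disjoint ∧
      Disjoint (T.biUnion id) (B \ B') := by
    intro B'
    induction B' using Finset.induction_on with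
    | empty => exact fun _ => ⟨T₀, by simpa using hc, hT₀, hd₀, by simpa using hB₀⟩
    | insert v s hv ih =>
      intro hs
      obtain ⟨T, hTc, hT, hd, hTB⟩ := ih ((Finset.subset_insert v s).trans hs)
      have hvB : v ∈ B := hs (Finset.mem_insert_self v s)
      have hsB : s.card ≤ B.card := Finset.card_le_card ((Finset.subset_insert v s).trans hs)
      have hTu := card_biUnion_le_three_mul hT
      have h1 := Finset.le_card_sdiff (T.biUnion id ∪ B) (G.neighborFinset v)
      have h2 := Finset.card_union_le (T.biUnion id) B
      have h3 := hdeg v hvB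
      rw [card_neighborFinset_eq_degree] at h1
      obtain ⟨x, hx, y, hy, hxy⟩ := hH (G.neighborFinset v \ (T.biUnion id ∪ B)) (by omega)
      simp only [Finset.mem_sdiff, mem_neighborFinset, Finset.mem_union, not_or] at hx hy
      have ht : (G ⊔ H).IsNClique 3 {v, x, y} :=
        is3Clique_triple_iff.2 ⟨Or.inl hx.1, Or.inl hy.1, Or.inr hxy⟩
      have hvT : v ∉ T.biUnion id := fun h =>
        Finset.disjoint_left.1 hTB h (Finset.mem_sdiff.2 ⟨hvB, hv⟩)
      have htT : Disjoint ({v, x, y} : Finset V) (T.biUnion id) := by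
        rw [Finset.disjoint_left]
        intro u hu
        simp only [Finset.mem_insert, Finset.mem_singleton] at hu
        rcases hu with rfl | rfl | rfl
        exacts [hvT, hx.2.1, hy.2.1]
      obtain ⟨k1, k2, k3⟩ := exists_insert_disjoint_triangle hT hd ht htT
      refine ⟨insert {v, x, y} T, ?_, k2, k3, ?_⟩
      · rw [k1, hTc, Finset.card_insert_of_notMem hv, add_assoc]
      · rw [Finset.biUnion_insert, Finset.disjoint_union_left]
        constructor
        · rw [Finset.disjoint_left]
          intro u hu hu'
          simp only [id, Finset.mem_insert, Finset.mem_singleton] at hu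
          simp only [Finset.mem_sdiff, Finset.mem_insert, not_or] at hu'
          rcases hu with rfl | rfl | rfl
          exacts [hu'.2.1 rfl, hx.2.2 hu'.1, hy.2.2 hu'.1]
        · exact Finset.disjoint_of_subset_right
            (Finset.sdiff_subset_sdiff le_rfl (Finset.subset_insert v s)) hTB
  obtain ⟨T, h1, h2, h3, -⟩ := key B subset_rfl
  exact ⟨T, h1, h2, h3⟩

end SimpleGraph

/-! ### Assembly and constants -/

theorem mainTheorem5 :
    ∃ C : ℝ, 0 < C ∧
      ∀ ε : ℝ, 0 < ε → ∃ n₀ : ℕ, ∀ n : ℕ, n₀ ≤ n →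
        ∀ m : ℕ, 1 ≤ m → (m : ℝ) ≤ (n : ℝ) / 256 →
          ∀ (G : SimpleGraph (Fin n)) [DecidableRel G.Adj], m ≤ G.minDegree →
            ∀ p : unitInterval, C * Real.log (n : ℝ) / (n : ℝ) ≤ (p : ℝ) →
              1 - ε ≤ (SimpleGraph.binomialRandom (Fin n) p).real
                {H : SimpleGraph (Fin n) | (G ⊔ H).HasDisjointTriangles m} := by
  -- The constant comes from the independent-set bound; the other needs only 128. Each bad event
  -- costs at most 1/n.
  refine ⟨32768, by norm_num, fun ε hε => ⟨⌈2 / ε⌉₊, ?_⟩⟩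
  intro n hn m hm hmn G _ hG p hp
  have hmn' : 256 * m ≤ n := by
    have : (256 : ℝ) * m ≤ n := by linarith
    exact_mod_cast this
  have hnpos : (256 : ℝ) ≤ n := by
    have : 256 ≤ n := by omega
    exact_mod_cast this
  have hnε : 2 / n ≤ ε := by
    have := Nat.ceil_le.1 hn
    rw [div_le_iff₀ hε] at this
    rw [div_le_iff₀ (by linarith)]
    linarith
  have hp' : 128 * Real.log n / n ≤ (p : ℝ) := by
    refine le_trans ?_ hp
    have : 0 ≤ Real.log n := Real.log_nonneg (by linarith)
    gcongr
    norm_num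
  set high : Finset (Fin n) := Finset.univ.filter fun v => n ≤ 32 * G.degree v with hhigh
  obtain ⟨B, hBhigh, hBm, hBor⟩ : ∃ B ⊆ high, B.card ≤ m ∧ (B.card = m ∨ B = high) := by
    rcases le_total m high.card with h | h
    · obtain ⟨B, hB, hBc⟩ := Finset.exists_subset_card_eq h
      exact ⟨B, hB, hBc.le, Or.inl hBc⟩
    · exact ⟨high, subset_rfl, h, Or.inr rfl⟩
  obtain ⟨k, rfl⟩ : ∃ k, m = k + B.card := ⟨m - B.card, by omega⟩
  set bad₁ : Set (SimpleGraph (Fin n)) := {H | ∃ U : Finset (Fin n), Disjoint B U ∧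
    U.card = 3 * k ∧ ∀ t, (G ⊔ H).IsNClique 3 t → ¬ (Disjoint t B ∧ Disjoint t U)} with hbad₁
  set bad₂ : Set (SimpleGraph (Fin n)) := {H | ∃ S : Finset (Fin n), Fintype.card (Fin n) ≤
    64 * S.card ∧ ∀ x ∈ S, ∀ y ∈ S, ¬ H.Adj x y} with hbad₂
  have hgood : ∀ H : SimpleGraph (Fin n), (1 ≤ k → H ∉ bad₁) → H ∉ bad₂ →
      (G ⊔ H).HasDisjointTriangles (k + B.card) := by
    intro H h1 h2
    have h2' : ∀ S : Finset (Fin n), Fintype.card (Fin n) ≤ 64 * S.card →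
        ∃ x ∈ S, ∃ y ∈ S, H.Adj x y := by
      intro S hS
      by_contra! h
      exact h2 ⟨S, hS, h⟩
    obtain ⟨T, hTc, hT, hd, hTB⟩ : ∃ T : Finset (Finset (Fin n)), T.card = k ∧
        (∀ t ∈ T, (G ⊔ H).IsNClique 3 t) ∧ (T : Set (Finset (Fin n))).Pairwise Disjoint ∧
        Disjoint (T.biUnion id) B := by
      rcases Nat.eq_zero_or_pos k with rfl | hk
      · exact ⟨∅, by simp⟩
      · refine SimpleGraph.exists_disjoint_triangles_avoiding (G ⊔ H) B k
          (by rw [Fintype.card_fin]; omega) fun U hBU hU => ?_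
        by_contra! h
        exact h1 hk ⟨U, hBU, hU, fun t ht htt => h t ht htt.1 htt.2⟩
    refine SimpleGraph.exists_disjoint_triangles_extend G H B k (by simpa using hmn') ?_ h2'
      T hTc hT hd hTB
    intro v hv
    simpa using (Finset.mem_filter.1 (hBhigh hv)).2
  have hP₁ : 1 ≤ k → (SimpleGraph.binomialRandom (Fin n) p).real bad₁ ≤ 1 / n := by
    intro hk
    have := SimpleGraph.binomialRandom_real_exists_no_triangle_disjoint_le G p B k hk
      (by simpa using hmn')
      (fun v => by
        have : k + B.card ≤ G.degree v := hG.trans (G.minDegree_le_degree v)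
        convert this)
      (fun v hv => by
        have hvh : v ∉ high := by
          -- Since k ≥ 1, `B` has fewer than m elements, hence contains every high-degree vertex.
          rcases hBor with h | h
          · omega
          · rwa [← h]
        have : 32 * G.degree v ≤ Fintype.card (Fin n) := by
          simp only [hhigh, Finset.mem_filter, Finset.mem_univ, true_and, not_le] at hvh
          simpa using hvh.le
        convert this)
      (by simpa using hp')
    rwa [Fintype.card_fin] at this
  have hP₂ : (SimpleGraph.binomialRandom (Fin n) p).real bad₂ ≤ 1 / n := by
    have := SimpleGraph.binomialRandom_real_exists_large_independent_le (V := Fin n) p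
      (by rw [Fintype.card_fin]; omega) (by simpa using hp)
    convert this using 2
    simp
  set bad := {H : SimpleGraph (Fin n) | 1 ≤ k ∧ H ∈ bad₁} ∪ bad₂ with hbad
  have hPbad : (SimpleGraph.binomialRandom (Fin n) p).real bad ≤ 2 / n := by
    refine (measureReal_union_le _ _).trans ?_
    have : (SimpleGraph.binomialRandom (Fin n) p).real {H | 1 ≤ k ∧ H ∈ bad₁} ≤ 1 / n := by
      by_cases hk : 1 ≤ k
      · simpa [hk] using hP₁ hk
      · simp [hk]
    calc _ ≤ (1 : ℝ) / n + 1 / n := add_le_add this hP₂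
      _ = 2 / n := by ring
  have hcover : (SimpleGraph.binomialRandom (Fin n) p).real Set.univ ≤
      (SimpleGraph.binomialRandom (Fin n) p).real
        {H | (G ⊔ H).HasDisjointTriangles (k + B.card)} +
      (SimpleGraph.binomialRandom (Fin n) p).real bad := by
    refine (measureReal_mono ?_).trans (measureReal_union_le _ _)
    intro H _
    by_cases h : H ∈ bad
    · exact Or.inr h
    · refine Or.inl (hgood H (fun hk h1 => h (Or.inl ⟨hk, h1⟩)) fun h2 => h (Or.inr h2))
  rw [probReal_univ] at hcover
  linarith
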